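/- Let $S$ be a finite set, $\mathbb A=S^{\mathbb N}=\{(x_0,x_1,\dots):x_i\in S\}$ with the product $\sigma$-algebra, $\sigma(x_0,x_1,\dots)=(x_1,x_2,\dots)$ the left shift, $\theta\in(0,1)$, and $d(x,y)=\theta^{\inf\{n\ge0:\,x_n\ne y_n\}}$ (with $d(x,x)=0$). For $f:\mathbb A\to\mathbb R$ let $\|f\|$ denote any fixed number with $\|f\|\ge1$, $\sup|f|\le\|f\|$ and $|f(x)-f(y)|\le\|f\|\,d(x,y)$ for all $x,y$; $f$ is called Lipschitz if such a number exists. Let $\phi_p$ be a Lipschitz potential which is normalized, $\sum_{s\in S}e^{\phi_p(sx)}=1$ for all $x\in\mathbb A$, and let $\mu$ be an equilibrium state of $\phi_p$, i.e. a shift-invariant probability measure on $\mathbb A$ that maximizes $h_\nu+\int\phi_p\,d\nu$ over all shift-invariant probability measures $\nu$; here $h_\nu=\lim_{n}\frac1n H_n(\nu)=\inf_{n\ge1}\frac1nH_n(\nu)$ is the entropy of the shift, with $H_n(\nu)=-\sum_{w\in S^n}\nu[w]\log\nu[w]$ and $[w]$ the cylinder of sequences beginning with $w$. Put $$a=1-\exp\big(-\|\phi_p\|(1-\theta)^{-1}\big),\qquad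 \epsilon\in\big(0,\min\{1-a,1-\theta\}\big),\qquad U=\frac{\log(1-\epsilon)}{\log[\theta\epsilon(1-\epsilon-\theta)]-\log(2\|\phi_p\|)},$$ $$z_0\in\Big(1,\min\Big\{\Big(\frac{a+\epsilon/2}{a}\Big)^{U},\frac{\theta+\epsilon}{\theta},\frac{1-\epsilon}{\theta},e^2\Big\}\Big).$$ Then for every Lipschitz observable $\phi:\mathbb A\to\mathbb R$ with $\int\phi\,d\mu=0$, every $u>0$ and every integer $n\ge1$, $$\mu\Big(\Big|\frac1n\sum_{i=0}^{n-1}\phi\circ\sigma^i\Big|\ge u\Big)\le 2\exp\Big(\frac{u(1-z_0^{-1/2})(1-a-\epsilon)\ln\sqrt{z_0}}{36\,\|\phi\|\,z_0^{1/2}}\Big)\exp\Big(-\frac{u^2n(1-z_0^{-1/2})^2(1-a-\epsilon)^2(\ln\sqrt{z_0})^2}{72\,\|\phi\|^2}\Big).$$ -/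

import Mathlib

namespace MarkovShift

/-- The left shift `σ (x₀, x₁, …) = (x₁, x₂, …)` on the space `ℕ → S` of one-sided sequences. -/
def shift {S : Type*} (x : ℕ → S) : ℕ → S := fun n => x (n + 1)

/-- The sequence `a x = (a, x₀, x₁, …)`. -/
def prepend {S : Type*} (a : S) (x : ℕ → S) : ℕ → S
  | 0 => a
  | n + 1 => x n

open Classical in
/-- The distance `d(x, y) = θ ^ inf {n ≥ 0 : xₙ ≠ yₙ}`; for `x = y` the infimum is `∞` and the
distance is `0`. -/
noncomputable def shiftDist {S : Type*} (θ : ℝ) (x y : ℕ → S) : ℝ :=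
  if x = y then 0 else θ ^ sInf {n : ℕ | x n ≠ y n}

/-- `M` is an admissible value of the Lipschitz constant `‖f‖` of `f`: it is at least `1`, bounds
the sup norm of `f` and is a Lipschitz constant of `f` for the distance `shiftDist θ`. -/
structure IsLipschitzBound {S : Type*} (θ : ℝ) (f : (ℕ → S) → ℝ) (M : ℝ) : Prop where
  one_le : 1 ≤ M
  abs_le : ∀ x, |f x| ≤ M
  abs_sub_le : ∀ x y, |f x - f y| ≤ M * shiftDist θ x y

/-- A potential `p` is normalized if `∑ a, exp (p (a x)) = 1` for every `x`. -/
def IsNormalized {S : Type*} [Fintype S] (p : (ℕ → S) → ℝ) : Prop :=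
  ∀ x : ℕ → S, ∑ a : S, Real.exp (p (prepend a x)) = 1

/-- The cylinder of all sequences that begin with the word `w`. -/
def cylinder {S : Type*} {n : ℕ} (w : Fin n → S) : Set (ℕ → S) :=
  {x | ∀ i : Fin n, x i = w i}

/-- The Shannon entropy `-∑ μ[w] log μ[w]` of the partition into cylinders of length `n`. -/
noncomputable def blockEntropy {S : Type*} [Fintype S] [MeasurableSpace S]
    (μ : MeasureTheory.Measure (ℕ → S)) (n : ℕ) : ℝ :=
  ∑ w : Fin n → S, Real.negMulLog (μ.real (cylinder w))

/-- The measure-theoretic entropy of the shift with respect to an invariant probability measure: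
`lim Hₙ / n = inf_{n ≥ 1} Hₙ / n`, where `Hₙ` is the entropy of the partition into `n`-cylinders
(the sequence `Hₙ` is subadditive, so that the limit exists and is the infimum). -/
noncomputable def entropy {S : Type*} [Fintype S] [MeasurableSpace S]
    (μ : MeasureTheory.Measure (ℕ → S)) : ℝ :=
  ⨅ n : ℕ, blockEntropy μ (n + 1) / ((n : ℝ) + 1)

/-- `μ` is a shift-invariant probability measure. -/
structure IsInvariantProbability {S : Type*} [MeasurableSpace S]
    (μ : MeasureTheory.Measure (ℕ → S)) : Prop where
  isProbabilityMeasure : MeasureTheory.IsProbabilityMeasure μ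
  measurePreserving : MeasureTheory.MeasurePreserving shift μ μ

/-- `μ` is an equilibrium state of the potential `p`: a shift-invariant probability measure that
maximizes entropy plus the mean of the potential among all shift-invariant probability measures. -/
structure IsEquilibriumState {S : Type*} [Fintype S] [MeasurableSpace S]
    (p : (ℕ → S) → ℝ) (μ : MeasureTheory.Measure (ℕ → S)) : Prop where
  invariant : IsInvariantProbability μ
  maximal : ∀ ν : MeasureTheory.Measure (ℕ → S), IsInvariantProbability ν →
    entropy ν + ∫ x, p x ∂ν ≤ entropy μ + ∫ x, p x ∂μ

end MarkovShift

/-! Write `𝓛` for the transfer operator of the normalized potential. The proof has two halves.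

An equilibrium state satisfies `∫ 𝓛 f dμ = ∫ f dμ`. A measure `ν` with this property exists by a
Krylov–Bogoliubov argument, and Jensen's inequality gives it free energy `h + ∫ p ≥ 0`; by
maximality the free energy of `μ` is nonnegative too. On the other hand, up to geometrically small
errors, each increment of `Hₙ(μ) + n ∫ p` is minus the relative entropy between the true cylinder
masses and those obtained by drawing the first letter from the kernel `exp p`. Relative entropy
dominates squared Hellinger distance, so these distances are summable, hence tend to zero, and `μ`
is a fixed point of the dual of `𝓛` (`isTransferInvariant_of_free_energy_nonneg`).

For such a measure the backward process draws letters from `exp p`. The sums `h_j = ∑ k < j, 𝓛ᵏ φ`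
have an oscillation bound `K` independent of `j`, by coupling two backward chains
(`transferSum_sub_le_oscModulus`). Since `h_{j+1} = φ + 𝓛 h_j`, Birkhoff sums have a martingale
structure: integrating out one letter at a time costs one Hoeffding factor `exp (t² K² / 8)`
(`integral_exp_transfer_add_le`). Chernoff's bound gives the tail `2 exp (-n u² / K²)`. Finally the
constant in the theorem is weaker: its rate factor is at most `(1 - a)²`, and `K (1 - a)² ≤ M`. -/

namespace MarkovShift

open Filter Topology MeasureTheory ProbabilityTheory
open scoped CompactlySupported

/-! ### Shift, prepending and the distance -/

section Distance

variable {S : Type*}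

@[simp] lemma prepend_zero (a : S) (x : ℕ → S) : prepend a x 0 = a := rfl

@[simp] lemma prepend_succ (a : S) (x : ℕ → S) (n : ℕ) : prepend a x (n + 1) = x n := rfl

@[simp] lemma shift_prepend (a : S) (x : ℕ → S) : shift (prepend a x) = x := rfl

lemma prepend_shift (x : ℕ → S) : prepend (x 0) (shift x) = x := by
  funext n
  cases n <;> rfl

lemma prepend_injective (a : S) : Function.Injective (prepend a) := fun x y h => by
  rw [← shift_prepend a x, h, shift_prepend]

lemma shiftDist_nonneg {θ : ℝ} (hθ : 0 ≤ θ) (x y : ℕ → S) : 0 ≤ shiftDist θ x y := by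
  unfold shiftDist
  split_ifs <;> positivity

lemma shiftDist_le_one {θ : ℝ} (hθ : 0 ≤ θ) (hθ' : θ ≤ 1) (x y : ℕ → S) :
    shiftDist θ x y ≤ 1 := by
  unfold shiftDist
  split_ifs
  · exact zero_le_one
  · exact pow_le_one₀ hθ hθ'

lemma shiftDist_le_pow {θ : ℝ} (hθ : 0 ≤ θ) (hθ' : θ ≤ 1) {x y : ℕ → S} {k : ℕ}
    (h : ∀ i < k, x i = y i) : shiftDist θ x y ≤ θ ^ k := by
  unfold shiftDist
  split_ifs with hxy
  · positivity
  · refine pow_le_pow_of_le_one hθ hθ' ?_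
    by_contra hlt
    push Not at hlt
    exact (Nat.sInf_mem (Function.ne_iff.1 hxy) : x _ ≠ y _) (h _ hlt)

lemma shiftDist_prepend (θ : ℝ) (a : S) (x y : ℕ → S) :
    shiftDist θ (prepend a x) (prepend a y) = θ * shiftDist θ x y := by
  unfold shiftDist
  by_cases hxy : x = y
  · simp [hxy]
  · rw [if_neg hxy, if_neg (fun h => hxy (prepend_injective a h)), ← pow_succ']
    congr 1
    have hne : {n | x n ≠ y n}.Nonempty := Function.ne_iff.1 hxy
    apply le_antisymm
    · exact Nat.sInf_le (Nat.sInf_mem hne : x _ ≠ y _)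
    · refine le_csInf (s := {n | prepend a x n ≠ prepend a y n}) (hne.elim fun n hn => ⟨n + 1, hn⟩) ?_
      rintro (_ | n) hn
      · exact absurd rfl hn
      · exact Nat.succ_le_succ (Nat.sInf_le hn)

end Distance

/-! ### Continuity and clopen cylinders -/

section Topology

variable {S : Type*} [TopologicalSpace S]

lemma continuous_shift : Continuous (shift : (ℕ → S) → (ℕ → S)) :=
  continuous_pi fun n => continuous_apply (n + 1)

lemma continuous_prepend (a : S) : Continuous (prepend a) := by
  refine continuous_pi fun n => ?_
  cases n with
  | zero => exact continuous_const
  | succ n => exact continuous_apply n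

lemma isClopen_cylinder [DiscreteTopology S] {n : ℕ} (w : Fin n → S) : IsClopen (cylinder w) := by
  have : cylinder w = ⋂ i : Fin n, (fun x : ℕ → S => x i) ⁻¹' {w i} := by
    ext x
    simp [cylinder]
  rw [this]
  exact isClopen_iInter_of_finite fun i =>
    (isClopen_discrete _).preimage (continuous_apply (i : ℕ))

lemma IsLipschitzBound.continuous [DiscreteTopology S] {θ : ℝ} (hθ : θ ∈ Set.Ioo (0 : ℝ) 1)
    {f : (ℕ → S) → ℝ} {M : ℝ} (h : IsLipschitzBound θ f M) : Continuous f := by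
  refine continuous_iff_continuousAt.2 fun x => Metric.tendsto_nhds.2 fun e he => ?_
  have hM : 0 < M := zero_lt_one.trans_le h.one_le
  obtain ⟨k, hk⟩ := exists_pow_lt_of_lt_one (div_pos he hM) hθ.2
  have hmem : cylinder (fun i : Fin k => x i) ∈ 𝓝 x :=
    (isClopen_cylinder _).isOpen.mem_nhds fun i => rfl
  filter_upwards [hmem] with y hy
  rw [Real.dist_eq]
  refine (h.abs_sub_le y x).trans_lt ?_
  have : shiftDist θ y x ≤ θ ^ k := shiftDist_le_pow hθ.1.le hθ.2.le fun i hi => hy ⟨i, hi⟩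
  calc M * shiftDist θ y x ≤ M * θ ^ k := by gcongr
    _ < M * (e / M) := by gcongr
    _ = e := by field_simp

end Topology

/-! ### Algebra of the transfer operator -/

section Operator

variable {S : Type*} [Fintype S]

/-- The transfer operator `f ↦ ∑ a, exp (p (a x)) f (a x)` of the potential `p`. -/
noncomputable def transfer (p f : (ℕ → S) → ℝ) (x : ℕ → S) : ℝ :=
  ∑ a : S, Real.exp (p (prepend a x)) * f (prepend a x)

lemma transfer_continuous [TopologicalSpace S] {p f : (ℕ → S) → ℝ} (hp : Continuous p)
    (hf : Continuous f) : Continuous (transfer p f) :=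
  continuous_finsetSum _ fun a _ => ((Real.continuous_exp.comp
    (hp.comp (continuous_prepend a))).mul (hf.comp (continuous_prepend a)))

lemma transfer_mono {p f g : (ℕ → S) → ℝ} (h : ∀ x, f x ≤ g x) (x : ℕ → S) :
    transfer p f x ≤ transfer p g x :=
  Finset.sum_le_sum fun _ _ => mul_le_mul_of_nonneg_left (h _) (Real.exp_nonneg _)

lemma transfer_const {p : (ℕ → S) → ℝ} (hp : IsNormalized p) (c : ℝ) :
    transfer p (fun _ => c) = fun _ => c := by
  funext x
  rw [transfer, ← Finset.sum_mul, hp x, one_mul]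

lemma transfer_mul_comp_shift (p f g : (ℕ → S) → ℝ) :
    transfer p (fun x => f x * g (shift x)) = fun x => transfer p f x * g x := by
  funext x
  simp only [transfer, shift_prepend, Finset.sum_mul, mul_assoc]

lemma transfer_comp_shift {p : (ℕ → S) → ℝ} (hp : IsNormalized p) (g : (ℕ → S) → ℝ) :
    transfer p (fun x => g (shift x)) = g := by
  have := transfer_mul_comp_shift p (fun _ => 1) g
  simpa [transfer_const hp] using this

lemma transfer_add (p f g : (ℕ → S) → ℝ) :
    transfer p (fun x => f x + g x) = fun x => transfer p f x + transfer p g x := by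
  funext x
  simp only [transfer, mul_add, Finset.sum_add_distrib]

lemma transfer_const_mul (p : (ℕ → S) → ℝ) (c : ℝ) (f : (ℕ → S) → ℝ) :
    transfer p (fun x => c * f x) = fun x => c * transfer p f x := by
  funext x
  simp only [transfer, Finset.mul_sum, mul_left_comm]

end Operator

/-- Two averages over a finite set with comparable weights are as close as a coupling of the
weights allows. -/
lemma sum_mul_sub_sum_mul_le {S : Type*} [Fintype S] [Nonempty S] {P Q f g : S → ℝ} {c A B : ℝ}
    (hP : ∑ a, P a = 1) (hQ : ∑ a, Q a = 1) (hP0 : ∀ a, 0 ≤ P a) (hc : c ≤ 1)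
    (hPQ : ∀ a, c * P a ≤ Q a) (hc0 : 0 ≤ c)
    (hfg : ∀ a, f a - g a ≤ A) (hB : ∀ a b, f a - g b ≤ B) :
    ∑ a, P a * f a - ∑ a, Q a * g a ≤ c * A + (1 - c) * B := by
  -- Both averages share the mass `c * P`. The residual masses equal `1 - c`: that of `P` is charged
  -- at most `f m`, that of `Q` at least `f m - B`.
  obtain ⟨m, hm⟩ := Finite.exists_max f
  have h1 : ∑ a, c * P a * (f a - g a) ≤ ∑ a, c * P a * A :=
    Finset.sum_le_sum fun a _ => mul_le_mul_of_nonneg_left (hfg a) (mul_nonneg hc0 (hP0 a))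
  have h2 : ∑ a, (1 - c) * P a * f a ≤ ∑ a, (1 - c) * P a * f m :=
    Finset.sum_le_sum fun a _ =>
      mul_le_mul_of_nonneg_left (hm a) (mul_nonneg (sub_nonneg.2 hc) (hP0 a))
  have h3 : ∑ a, (Q a - c * P a) * (f m - B) ≤ ∑ a, (Q a - c * P a) * g a :=
    Finset.sum_le_sum fun a _ =>
      mul_le_mul_of_nonneg_left (by linarith [hB m a]) (sub_nonneg.2 (hPQ a))
  have e1 : ∑ a, c * P a * A = c * A := by rw [← Finset.sum_mul, ← Finset.mul_sum, hP, mul_one]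
  have e2 : ∑ a, (1 - c) * P a * f m = (1 - c) * f m := by
    rw [← Finset.sum_mul, ← Finset.mul_sum, hP, mul_one]
  have e3 : ∑ a, (Q a - c * P a) * (f m - B) = (1 - c) * (f m - B) := by
    rw [← Finset.sum_mul, Finset.sum_sub_distrib, ← Finset.mul_sum, hP, hQ, mul_one]
  have e : ∑ a, P a * f a - ∑ a, Q a * g a = ∑ a, c * P a * (f a - g a)
      + ∑ a, (1 - c) * P a * f a - ∑ a, (Q a - c * P a) * g a := by
    rw [← Finset.sum_add_distrib, ← Finset.sum_sub_distrib, ← Finset.sum_sub_distrib]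
    exact Finset.sum_congr rfl fun a _ => by ring
  rw [e]
  linarith

/-! ### Uniform oscillation of the sums of iterates, by coupling -/

section Contraction

variable {S : Type*} [Fintype S]

/-- The uniform bound on the oscillation of the sums `∑ k < n, 𝓛ᵏ φ` for a potential with Lipschitz
bound `L` and an observable with Lipschitz bound `M`. -/
noncomputable def oscBound (θ L M : ℝ) : ℝ := M / (1 - θ) * Real.exp (L * θ / (1 - θ))

/-- The bound on the variation of `∑ k < n, 𝓛ᵏ φ` between points at distance `d`. -/
noncomputable def oscModulus (θ L M d : ℝ) : ℝ :=
  M * d / (1 - θ) + (1 - Real.exp (-(L * θ * d / (1 - θ)))) * oscBound θ L M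

/-- The modulus increases with `d`, and at `d = 1` equality holds; this self-consistency dictates
the exponential factor in `oscBound`. -/
lemma oscModulus_le_oscBound {θ L M d : ℝ} (hθ : θ ∈ Set.Ioo (0 : ℝ) 1) (hL : 0 ≤ L) (hM : 0 ≤ M)
    (hd : d ≤ 1) : oscModulus θ L M d ≤ oscBound θ L M := by
  have h1 : 0 < 1 - θ := sub_pos.2 hθ.2
  have h0 := hθ.1
  have hmono : oscModulus θ L M d ≤ oscModulus θ L M 1 := by
    have hB : 0 ≤ oscBound θ L M := by unfold oscBound; positivity
    unfold oscModulus
    gcongr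
  refine hmono.trans_eq ?_
  have e : Real.exp (-(L * θ * 1 / (1 - θ))) * oscBound θ L M = M / (1 - θ) := by
    rw [oscBound, mul_left_comm, ← Real.exp_add]
    simp
  rw [oscModulus, sub_mul, e]
  ring

/-- One coupling step: with weight `exp (-L θ d)` both points receive the same letter and move to
distance `θ d`; otherwise the global bound is paid. The survival weights multiply up to `exp (-L θ d
/ (1 - θ))`, and the contributions of `φ` form a geometric series. -/
lemma oscModulus_step {θ L M d : ℝ} (hθ : θ ∈ Set.Ioo (0 : ℝ) 1) (hM : 0 ≤ M) (hL : 0 ≤ L)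
    (hd : 0 ≤ d) :
    M * d + (Real.exp (-(L * (θ * d))) * oscModulus θ L M (θ * d)
      + (1 - Real.exp (-(L * (θ * d)))) * oscBound θ L M) ≤ oscModulus θ L M d := by
  have h1 : 0 < 1 - θ := sub_pos.2 hθ.2
  have h0 := hθ.1
  have hr : Real.exp (-(L * θ * d / (1 - θ)))
      = Real.exp (-(L * (θ * d))) * Real.exp (-(L * θ * (θ * d) / (1 - θ))) := by
    rw [← Real.exp_add]
    congr 1
    field_simp
    ring
  have hq : Real.exp (-(L * (θ * d))) ≤ 1 := Real.exp_le_one_iff.2 (by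
    rw [neg_nonpos]; positivity)
  have hX : 0 ≤ M * (θ * d) / (1 - θ) := by positivity
  have hsplit : M * d / (1 - θ) = M * d + M * (θ * d) / (1 - θ) := by field_simp; ring
  unfold oscModulus
  rw [hr, hsplit]
  nlinarith [mul_le_mul_of_nonneg_right hq hX]

/-- The sums `∑ k < n, 𝓛ᵏ φ`. -/
noncomputable def transferSum (p φ : (ℕ → S) → ℝ) : ℕ → (ℕ → S) → ℝ
  | 0 => fun _ => 0
  | n + 1 => fun x => φ x + transfer p (transferSum p φ n) x

lemma transferSum_continuous [TopologicalSpace S] {p φ : (ℕ → S) → ℝ} (hp : Continuous p)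
    (hφ : Continuous φ) : ∀ n, Continuous (transferSum p φ n)
  | 0 => continuous_const
  | n + 1 => hφ.add (transfer_continuous hp (transferSum_continuous hp hφ n))

lemma transferSum_sub_le_oscModulus {θ L M : ℝ} (hθ : θ ∈ Set.Ioo (0 : ℝ) 1)
    {p φ : (ℕ → S) → ℝ} (hp : IsLipschitzBound θ p L) (hφ : IsLipschitzBound θ φ M)
    (hnorm : IsNormalized p) (n : ℕ) (x y : ℕ → S) :
    transferSum p φ n x - transferSum p φ n y ≤ oscModulus θ L M (shiftDist θ x y) := by
  have hL : 0 ≤ L := zero_le_one.trans hp.one_le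
  have hM : 0 ≤ M := zero_le_one.trans hφ.one_le
  have : Nonempty S := ⟨x 0⟩
  induction n generalizing x y with
  | zero =>
    have h1 : 0 < 1 - θ := sub_pos.2 hθ.2
    have h0 := hθ.1
    have hd := shiftDist_nonneg h0.le x y
    have hB : 0 ≤ oscBound θ L M := by unfold oscBound; positivity
    have he : Real.exp (-(L * θ * shiftDist θ x y / (1 - θ))) ≤ 1 :=
      Real.exp_le_one_iff.2 (by rw [neg_nonpos]; positivity)
    have := mul_nonneg (sub_nonneg.2 he) hB
    simp only [transferSum, sub_self, oscModulus]
    positivity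
  | succ n ih =>
    have hd := shiftDist_nonneg hθ.1.le x y
    refine le_trans ?_ (oscModulus_step hθ hM hL hd)
    have h1 := (le_abs_self _).trans (hφ.abs_sub_le x y)
    have h2 : transfer p (transferSum p φ n) x - transfer p (transferSum p φ n) y ≤
        Real.exp (-(L * (θ * shiftDist θ x y))) * oscModulus θ L M (θ * shiftDist θ x y)
          + (1 - Real.exp (-(L * (θ * shiftDist θ x y)))) * oscBound θ L M := by
      refine sum_mul_sub_sum_mul_le (hnorm x) (hnorm y) (fun a => Real.exp_nonneg _) ?_ ?_
        (Real.exp_nonneg _) ?_ ?_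
      · have := hθ.1
        exact Real.exp_le_one_iff.2 (by rw [neg_nonpos]; positivity)
      -- The common part of the two letter distributions: the potentials at `a x` and `a y` differ
      -- by at most `L θ d(x, y)`.
      · intro a
        rw [← Real.exp_add, Real.exp_le_exp]
        have := (le_abs_self _).trans (hp.abs_sub_le (prepend a x) (prepend a y))
        rw [shiftDist_prepend] at this
        linarith
      · intro a
        have := ih (prepend a x) (prepend a y)
        rwa [shiftDist_prepend] at this
      · intro a b
        exact (ih _ _).trans (oscModulus_le_oscBound hθ hL hM
          (shiftDist_le_one hθ.1.le hθ.2.le _ _))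
    simp only [transferSum]
    linarith

lemma transferSum_sub_le_oscBound {θ L M : ℝ} (hθ : θ ∈ Set.Ioo (0 : ℝ) 1)
    {p φ : (ℕ → S) → ℝ} (hp : IsLipschitzBound θ p L) (hφ : IsLipschitzBound θ φ M)
    (hnorm : IsNormalized p) (n : ℕ) (x y : ℕ → S) :
    transferSum p φ n x - transferSum p φ n y ≤ oscBound θ L M :=
  (transferSum_sub_le_oscModulus hθ hp hφ hnorm n x y).trans
    (oscModulus_le_oscBound hθ (zero_le_one.trans hp.one_le) (zero_le_one.trans hφ.one_le)
      (shiftDist_le_one hθ.1.le hθ.2.le _ _))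

end Contraction

/-- Hoeffding's lemma for a random variable of oscillation at most `K`. -/
lemma integral_exp_mul_le_of_sub_le {Ω : Type*} [MeasurableSpace Ω] {μ : Measure Ω}
    [IsProbabilityMeasure μ] {X : Ω → ℝ} (hX : Measurable X) {K : ℝ}
    (hK : ∀ x y, X x - X y ≤ K) (t : ℝ) :
    ∫ x, Real.exp (t * X x) ∂μ ≤ Real.exp (t * ∫ x, X x ∂μ + t ^ 2 * K ^ 2 / 8) := by
  obtain ⟨x₀⟩ : Nonempty Ω := μ.nonempty_of_neZero
  have : Nonempty Ω := ⟨x₀⟩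
  have hbdd : BddBelow (Set.range X) := ⟨X x₀ - K, by
    rintro _ ⟨y, rfl⟩
    linarith [hK x₀ y]⟩
  have hmem : ∀ x, X x ∈ Set.Icc (⨅ y, X y) ((⨅ y, X y) + K) := fun x =>
    ⟨ciInf_le hbdd x, by
      have : X x - K ≤ ⨅ y, X y := le_ciInf fun y => by linarith [hK x y]
      linarith⟩
  have h := (hasSubgaussianMGF_of_mem_Icc (μ := μ) hX.aemeasurable
    (Eventually.of_forall hmem)).mgf_le t
  have e : mgf (fun ω => X ω - ∫ x, X x ∂μ) μ t
      = Real.exp (-(t * ∫ x, X x ∂μ)) * ∫ x, Real.exp (t * X x) ∂μ := by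
    rw [mgf, ← integral_const_mul]
    congr 1
    funext x
    rw [← Real.exp_add]
    ring_nf
  rw [e, add_sub_cancel_left] at h
  have h2 : (((‖K‖₊ / 2) ^ 2 : NNReal) : ℝ) * t ^ 2 / 2 = t ^ 2 * K ^ 2 / 8 := by
    push_cast
    rw [div_pow, Real.norm_eq_abs, sq_abs]
    ring
  rw [h2] at h
  have h3 := mul_le_mul_of_nonneg_left h (Real.exp_nonneg (t * ∫ x, X x ∂μ))
  rwa [← mul_assoc, ← Real.exp_add, ← Real.exp_add, add_neg_cancel, Real.exp_zero, one_mul] at h3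

/-- Hoeffding's lemma for a finitely supported distribution. -/
lemma sum_mul_exp_mul_le_of_sub_le {S : Type*} [Fintype S] {P X : S → ℝ} (hP0 : ∀ a, 0 ≤ P a)
    (hP : ∑ a, P a = 1) {K : ℝ} (hK : ∀ a b, X a - X b ≤ K) (t : ℝ) :
    ∑ a, P a * Real.exp (t * X a) ≤ Real.exp (t * ∑ a, P a * X a + t ^ 2 * K ^ 2 / 8) := by
  let _ : MeasurableSpace S := ⊤
  have : DiscreteMeasurableSpace S := ⟨fun _ => trivial⟩
  let m : Measure S := ∑ a, (P a).toNNReal • Measure.dirac a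
  have : IsProbabilityMeasure m := ⟨by
    
    simp only [m, Measure.coe_finsetSum, Finset.sum_apply, Measure.coe_nnreal_smul_apply,
      measure_univ, mul_one]
    change ∑ a, ENNReal.ofReal (P a) = 1
    rw [← ENNReal.ofReal_sum_of_nonneg fun a _ => hP0 a, hP, ENNReal.ofReal_one]⟩
  have hint (f : S → ℝ) : ∫ a, f a ∂m = ∑ a, P a * f a := by
    rw [integral_finsetSum_measure fun a _ => .of_finite]
    exact Finset.sum_congr rfl fun a _ => by
      rw [integral_smul_nnreal_measure, integral_dirac, NNReal.smul_def, smul_eq_mul,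
        Real.coe_toNNReal _ (hP0 a)]
  have := integral_exp_mul_le_of_sub_le (μ := m) (measurable_of_finite X) hK t
  rwa [hint, hint] at this

/-- The measure `μ` is fixed by the dual of the transfer operator of `p`. -/
def IsTransferInvariant {S : Type*} [Fintype S] [TopologicalSpace S] [MeasurableSpace S] (p : (ℕ → S) → ℝ)
    (μ : Measure (ℕ → S)) : Prop :=
  ∀ f : (ℕ → S) → ℝ, Continuous f → ∫ x, transfer p f x ∂μ = ∫ x, f x ∂μ

lemma sum_comp_iterate_shift_succ {S : Type*} (φ : (ℕ → S) → ℝ) (n : ℕ) (x : ℕ → S) :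
    ∑ i ∈ Finset.range (n + 1), φ (shift^[i] x)
      = φ x + ∑ i ∈ Finset.range n, φ (shift^[i] (shift x)) := by
  rw [Finset.sum_range_succ', add_comm]
  rfl

lemma continuous_sum_comp_iterate_shift {S : Type*} [TopologicalSpace S] {φ : (ℕ → S) → ℝ} (hφ : Continuous φ)
    (n : ℕ) : Continuous fun x => ∑ i ∈ Finset.range n, φ (shift^[i] x) :=
  continuous_finsetSum _ fun i _ => hφ.comp (continuous_shift.iterate i)

/-! ### Exponential moments and concentration of Birkhoff sums -/

section

variable {S : Type*} [Fintype S] [TopologicalSpace S] [DiscreteTopology S] [MeasurableSpace S] [BorelSpace S]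

lemma integrable_of_continuous {μ : Measure (ℕ → S)} [IsFiniteMeasure μ] {f : (ℕ → S) → ℝ}
    (hf : Continuous f) : Integrable f μ :=
  hf.integrable_of_hasCompactSupport (.of_compactSpace f)

variable {p φ : (ℕ → S) → ℝ} {μ : Measure (ℕ → S)} [IsProbabilityMeasure μ]

lemma integral_transferSum_eq_zero (hp : Continuous p) (hφ : Continuous φ)
    (hμ : IsTransferInvariant p μ) (hmean : ∫ x, φ x ∂μ = 0) (n : ℕ) :
    ∫ x, transferSum p φ n x ∂μ = 0 := by
  induction n with
  | zero => simp [transferSum]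
  | succ n ih =>
    have hc := transferSum_continuous hp hφ n
    simp only [transferSum]
    rw [integral_add (integrable_of_continuous hφ)
      (integrable_of_continuous (transfer_continuous hp hc)), hmean, hμ _ hc, ih, add_zero]

/-- Induction on `n`, with `j` free because each step raises it by one. The term `t 𝓛 h_j` absorbs
the first summand `φ` into `h_{j+1}`; what remains depends on `shift x` only, so duality averages
over the first letter, and Hoeffding replaces `h_{j+1}` by `𝓛 h_{j+1}`. The last, `(n + 1)`-st
factor is Hoeffding's lemma for `μ` itself, where the mean is zero. -/
lemma integral_exp_transfer_add_le (hp : Continuous p) (hφ : Continuous φ) (hnorm : IsNormalized p)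
    (hμ : IsTransferInvariant p μ) (hmean : ∫ x, φ x ∂μ = 0) {K : ℝ}
    (hK : ∀ n x y, transferSum p φ n x - transferSum p φ n y ≤ K) (t : ℝ) (n j : ℕ) :
    ∫ x, Real.exp (t * transfer p (transferSum p φ j) x
        + t * ∑ i ∈ Finset.range n, φ (shift^[i] x)) ∂μ
      ≤ Real.exp ((n + 1 : ℕ) * (t ^ 2 * K ^ 2 / 8)) := by
  induction n generalizing j with
  | zero =>
    obtain ⟨x₀⟩ : Nonempty (ℕ → S) := μ.nonempty_of_neZero
    have : Nonempty S := ⟨x₀ 0⟩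
    have hc := transferSum_continuous hp hφ j
    have hosc : ∀ x y, transfer p (transferSum p φ j) x - transfer p (transferSum p φ j) y ≤ K :=
      -- With no common mass the coupling bound says only that averaging does not increase
      -- oscillation.
      fun x y => (sum_mul_sub_sum_mul_le (c := 0) (A := K) (hnorm x) (hnorm y)
        (fun _ => Real.exp_nonneg _) zero_le_one (fun a => by simpa using Real.exp_nonneg _) le_rfl
        (fun a => hK j _ _) (fun a b => hK j _ _)).trans (by simp)
    have h := integral_exp_mul_le_of_sub_le (μ := μ) (transfer_continuous hp hc).measurable hosc t
    rw [hμ _ hc, integral_transferSum_eq_zero hp hφ hμ hmean] at h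
    simpa using h
  | succ n ih =>
    have hc := transferSum_continuous hp hφ (j + 1)
    have hS := continuous_sum_comp_iterate_shift hφ n
    let f : (ℕ → S) → ℝ := fun x => Real.exp (t * transferSum p φ (j + 1) x)
    let g : (ℕ → S) → ℝ := fun x => Real.exp (t * ∑ i ∈ Finset.range n, φ (shift^[i] x))
    have hf : Continuous f := Real.continuous_exp.comp (hc.const_mul t)
    have hg : Continuous g := Real.continuous_exp.comp (hS.const_mul t)
    have e : ∀ x, Real.exp (t * transfer p (transferSum p φ j) x
        + t * ∑ i ∈ Finset.range (n + 1), φ (shift^[i] x)) = f x * g (shift x) := fun x => by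
      simp only [f, g]
      rw [sum_comp_iterate_shift_succ, ← Real.exp_add, transferSum]
      congr 1
      ring
    have hle : ∀ x, transfer p f x * g x ≤ Real.exp (t ^ 2 * K ^ 2 / 8) *
        Real.exp (t * transfer p (transferSum p φ (j + 1)) x
          + t * ∑ i ∈ Finset.range n, φ (shift^[i] x)) := fun x => by
      rw [Real.exp_add, ← mul_assoc, ← Real.exp_add, add_comm (t ^ 2 * K ^ 2 / 8)]
      exact mul_le_mul_of_nonneg_right (sum_mul_exp_mul_le_of_sub_le
        (fun a => Real.exp_nonneg _) (hnorm x) (fun a b => hK (j + 1) _ _) t) (Real.exp_nonneg _)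
    calc _ = ∫ x, f x * g (shift x) ∂μ := by simp_rw [e]
      _ = ∫ x, transfer p f x * g x ∂μ := by
        refine (hμ _ (hf.mul (hg.comp continuous_shift))).symm.trans ?_
        exact congrArg (fun F => ∫ x, F x ∂μ) (transfer_mul_comp_shift p f g)
      _ ≤ ∫ x, Real.exp (t ^ 2 * K ^ 2 / 8) *
          Real.exp (t * transfer p (transferSum p φ (j + 1)) x
            + t * ∑ i ∈ Finset.range n, φ (shift^[i] x)) ∂μ :=
        integral_mono (integrable_of_continuous ((transfer_continuous hp hf).mul hg))
          (integrable_of_continuous (continuous_const.mul (Real.continuous_exp.comp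
            (((transfer_continuous hp hc).const_mul t).add (hS.const_mul t))))) hle
      _ ≤ Real.exp (t ^ 2 * K ^ 2 / 8) * Real.exp ((n + 1 : ℕ) * (t ^ 2 * K ^ 2 / 8)) := by
        rw [integral_const_mul]
        exact mul_le_mul_of_nonneg_left (ih (j + 1)) (Real.exp_nonneg _)
      _ = Real.exp ((n + 1 + 1 : ℕ) * (t ^ 2 * K ^ 2 / 8)) := by
        rw [← Real.exp_add]
        push_cast
        ring_nf

lemma mgf_sum_comp_iterate_shift_le (hp : Continuous p) (hφ : Continuous φ)
    (hnorm : IsNormalized p) (hμ : IsTransferInvariant p μ) (hmean : ∫ x, φ x ∂μ = 0) {K : ℝ}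
    (hK : ∀ n x y, transferSum p φ n x - transferSum p φ n y ≤ K) (t : ℝ) (n : ℕ) :
    mgf (fun x => ∑ i ∈ Finset.range n, φ (shift^[i] x)) μ t
      ≤ Real.exp ((n + 1 : ℕ) * (t ^ 2 * K ^ 2 / 8)) := by
  -- At `j = 0` the auxiliary sum vanishes.
  have h := integral_exp_transfer_add_le hp hφ hnorm hμ hmean hK t n 0
  simpa [transferSum, transfer_const hnorm, mgf] using h

/-- Concentration of Birkhoff averages when the sums `∑ k < n, 𝓛ᵏ φ` have oscillation at
most `K`. -/
lemma measureReal_le_abs_average_le (hp : Continuous p) (hφ : Continuous φ)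
    (hnorm : IsNormalized p) (hμ : IsTransferInvariant p μ) (hmean : ∫ x, φ x ∂μ = 0) {K : ℝ}
    (hK0 : 0 < K) (hK : ∀ n x y, transferSum p φ n x - transferSum p φ n y ≤ K) {u : ℝ}
    (hu : 0 < u) {n : ℕ} (hn : 1 ≤ n) :
    μ.real {x | u ≤ |(∑ i ∈ Finset.range n, φ (shift^[i] x)) / (n : ℝ)|}
      ≤ 2 * Real.exp (-(n * u ^ 2 / K ^ 2)) := by
  set B : (ℕ → S) → ℝ := fun x => ∑ i ∈ Finset.range n, φ (shift^[i] x)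
  have hn0 : (1 : ℝ) ≤ n := by exact_mod_cast hn
  -- The minimizer of `-t n u + (n + 1) t² K² / 8`; the minimum is `-(n u² / K²) * (2 n / (n + 1))`,
  -- and `2 n / (n + 1) ≥ 1`.
  set t : ℝ := 4 * n * u / ((n + 1) * K ^ 2)
  have ht : 0 ≤ t := by positivity
  have hint (s : ℝ) : Integrable (fun x => Real.exp (s * B x)) μ :=
    integrable_of_continuous (Real.continuous_exp.comp
      ((continuous_sum_comp_iterate_shift hφ n).const_mul s))
  have hexp : -t * (n * u) + (n + 1 : ℕ) * (t ^ 2 * K ^ 2 / 8) ≤ -(n * u ^ 2 / K ^ 2) := by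
    have e : -t * (n * u) + (n + 1 : ℕ) * (t ^ 2 * K ^ 2 / 8)
        = -(n * u ^ 2 / K ^ 2 * (2 * n / (n + 1))) := by
      simp only [t]
      push_cast
      field_simp
      ring
    rw [e, neg_le_neg_iff]
    refine le_mul_of_one_le_right (by positivity) ?_
    rw [le_div_iff₀ (by positivity)]
    linarith
  have h1 : μ.real {x | n * u ≤ B x} ≤ Real.exp (-(n * u ^ 2 / K ^ 2)) := by
    refine (measure_ge_le_exp_mul_mgf (n * u) ht (hint t)).trans ?_
    refine (mul_le_mul_of_nonneg_left
      (mgf_sum_comp_iterate_shift_le hp hφ hnorm hμ hmean hK t n) (Real.exp_nonneg _)).trans ?_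
    rw [← Real.exp_add]
    exact Real.exp_le_exp.2 hexp
  have h2 : μ.real {x | B x ≤ -(n * u)} ≤ Real.exp (-(n * u ^ 2 / K ^ 2)) := by
    refine (measure_le_le_exp_mul_mgf (-(n * u)) (neg_nonpos.2 ht) (hint (-t))).trans ?_
    refine (mul_le_mul_of_nonneg_left
      (mgf_sum_comp_iterate_shift_le hp hφ hnorm hμ hmean hK (-t) n) (Real.exp_nonneg _)).trans ?_
    rw [← Real.exp_add]
    refine Real.exp_le_exp.2 (le_trans (le_of_eq ?_) hexp)
    ring
  have hsub : {x | u ≤ |B x / (n : ℝ)|} ⊆ {x | n * u ≤ B x} ∪ {x | B x ≤ -(n * u)} := by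
    intro x hx
    have hx' : u ≤ |B x / (n : ℝ)| := hx
    rw [abs_div, abs_of_nonneg (by positivity : (0 : ℝ) ≤ n), le_div_iff₀ (by positivity),
      le_abs] at hx'
    rcases hx' with h | h
    · exact Or.inl (by simpa [mul_comm] using h)
    · exact Or.inr (show B x ≤ -(n * u) by linarith [mul_comm (n : ℝ) u])
  calc _ ≤ μ.real ({x | n * u ≤ B x} ∪ {x | B x ≤ -(n * u)}) := measureReal_mono hsub
    _ ≤ _ := measureReal_union_le _ _
    _ ≤ _ := by linarith

end

/-- Each of the factors `1 / (1 - θ)` and `exp (L θ / (1 - θ))` is at most `exp (L / (1 - θ))`. -/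
lemma oscBound_mul_sq_le {θ L M : ℝ} (hθ : θ ∈ Set.Ioo (0 : ℝ) 1) (hL : 1 ≤ L) (hM : 0 ≤ M) :
    oscBound θ L M * Real.exp (-(L * (1 - θ)⁻¹)) ^ 2 ≤ M := by
  have h1 : 0 < 1 - θ := sub_pos.2 hθ.2
  have h2 : (1 - θ)⁻¹ ≤ Real.exp (L * (1 - θ)⁻¹) := by
    refine le_trans ?_ (Real.add_one_le_exp _)
    have : (1 - θ)⁻¹ ≤ L * (1 - θ)⁻¹ := le_mul_of_one_le_left (by positivity) hL
    linarith
  have h3 : Real.exp (L * θ / (1 - θ)) ≤ Real.exp (L * (1 - θ)⁻¹) := by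
    rw [Real.exp_le_exp, ← div_eq_mul_inv]
    gcongr
    exact mul_le_of_le_one_right (by linarith) hθ.2.le
  set q := Real.exp (L * (1 - θ)⁻¹)
  calc oscBound θ L M * Real.exp (-(L * (1 - θ)⁻¹)) ^ 2
      = M * (1 - θ)⁻¹ * Real.exp (L * θ / (1 - θ)) * (q⁻¹) ^ 2 := by
        rw [oscBound, Real.exp_neg, div_eq_mul_inv M]
    _ ≤ M * q * q * (q⁻¹) ^ 2 := by gcongr
    _ = M := by
      have : q ≠ 0 := (Real.exp_pos _).ne'
      field_simp

/-- The first factor is at most `1` and the other two at most `1 - a` each, because `log z₀ ≤ ε < 1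
- a`. -/
lemma contraction_rate_le_sq {θ L a ε U z₀ : ℝ} (hθ : θ ∈ Set.Ioo (0 : ℝ) 1) (hL : 1 ≤ L)
    (ha : a = 1 - Real.exp (-(L * (1 - θ)⁻¹)))
    (hε : ε ∈ Set.Ioo (0 : ℝ) (min (1 - a) (1 - θ)))
    (hU : U = Real.log (1 - ε) / (Real.log (θ * ε * (1 - ε - θ)) - Real.log (2 * L)))
    (hz₁ : 1 < z₀) (hz₂ : z₀ ≤ ((a + ε / 2) / a) ^ U) :
    0 ≤ (1 - z₀ ^ (-(1 / 2) : ℝ)) * (1 - a - ε) * Real.log (√z₀) ∧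
      (1 - z₀ ^ (-(1 / 2) : ℝ)) * (1 - a - ε) * Real.log (√z₀)
        ≤ Real.exp (-(L * (1 - θ)⁻¹)) ^ 2 := by
  have hθ0 := hθ.1
  have h1 : 0 < 1 - θ := sub_pos.2 hθ.2
  have hε0 := hε.1
  have hεa : ε < 1 - a := hε.2.trans_le (min_le_left _ _)
  have hεθ : ε < 1 - θ := hε.2.trans_le (min_le_right _ _)
  have hδ : 1 - a = Real.exp (-(L * (1 - θ)⁻¹)) := by rw [ha]; ring
  have hδ1 : 1 - a ≤ 1 / 2 := by
    have h2 : 1 ≤ L * (1 - θ)⁻¹ := by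
      have : 1 ≤ (1 - θ)⁻¹ := (one_le_inv₀ h1).2 (by linarith)
      nlinarith
    have h3 : Real.exp (-(L * (1 - θ)⁻¹)) ≤ Real.exp (-1) := Real.exp_le_exp.2 (by linarith)
    have h4 : (2 : ℝ) ≤ Real.exp 1 := by linarith [Real.exp_one_gt_d9]
    rw [hδ]
    refine h3.trans ?_
    rw [Real.exp_neg, ← one_div]
    exact one_div_le_one_div_of_le (by norm_num) h4
  -- The denominator is negative and lies below the numerator, since `θ ε (1 - ε - θ) < 1 - ε` and
  -- `log (2 L) ≥ 0`.
  have hU1 : U ≤ 1 := by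
    have hX0 : 0 < θ * ε * (1 - ε - θ) := mul_pos (mul_pos hθ0 hε0) (by linarith)
    have hθε : θ * ε ≤ 1 := mul_le_one₀ hθ.2.le hε0.le (by linarith)
    have hX : θ * ε * (1 - ε - θ) < 1 - ε := by
      nlinarith [mul_le_mul_of_nonneg_right hθε (by linarith : 0 ≤ 1 - ε - θ)]
    have hlog : Real.log (θ * ε * (1 - ε - θ)) ≤ Real.log (1 - ε) := Real.log_le_log hX0 hX.le
    have hneg : Real.log (θ * ε * (1 - ε - θ)) < 0 := Real.log_neg hX0 (by linarith)
    have hpos : 0 ≤ Real.log (2 * L) := Real.log_nonneg (by linarith)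
    rw [hU, div_le_one_of_neg (by linarith)]
    linarith
  have ha0 : 1 / 2 ≤ a := by linarith
  have hratio : (1 : ℝ) ≤ (a + ε / 2) / a := by
    rw [le_div_iff₀ (by linarith)]
    linarith
  have hlogz : Real.log (√z₀) ≤ 1 - a := by
    -- From `U ≤ 1` and `log x ≤ x - 1`, the logarithm is at most `ε / (2 a)`, and `a ≥ 1 / 2`.
    have hz : Real.log z₀ ≤ ε := by
      calc Real.log z₀ ≤ Real.log (((a + ε / 2) / a) ^ U) := Real.log_le_log (by linarith) hz₂
        _ = U * Real.log ((a + ε / 2) / a) := Real.log_rpow (by linarith) U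
        _ ≤ 1 * Real.log ((a + ε / 2) / a) :=
          mul_le_mul_of_nonneg_right hU1 (Real.log_nonneg hratio)
        _ ≤ (a + ε / 2) / a - 1 := by
          rw [one_mul]
          exact Real.log_le_sub_one_of_pos (by linarith)
        _ ≤ ε := by
          rw [sub_le_iff_le_add, div_le_iff₀ (by linarith)]
          nlinarith
    rw [Real.log_sqrt (by linarith)]
    linarith
  have hlogz0 : 0 ≤ Real.log (√z₀) := by
    rw [Real.log_sqrt (by linarith)]
    exact div_nonneg (Real.log_nonneg hz₁.le) (by norm_num)
  have hr0 : 0 ≤ 1 - z₀ ^ (-(1 / 2) : ℝ) :=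
    sub_nonneg.2 (Real.rpow_le_one_of_one_le_of_nonpos hz₁.le (by norm_num))
  have hr1 : 1 - z₀ ^ (-(1 / 2) : ℝ) ≤ 1 := by
    linarith [Real.rpow_nonneg (zero_le_one.trans hz₁.le) (-(1 / 2) : ℝ)]
  have hδε : 0 ≤ 1 - a - ε := by linarith
  have hδε' : 1 - a - ε ≤ 1 - a := by linarith
  have hδ0 : 0 ≤ 1 - a := by linarith
  refine ⟨by positivity, ?_⟩
  rw [← hδ]
  calc (1 - z₀ ^ (-(1 / 2) : ℝ)) * (1 - a - ε) * Real.log (√z₀)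
      ≤ 1 * (1 - a) * (1 - a) := by gcongr
    _ = (1 - a) ^ 2 := by ring

/-! ### Finite words and cylinders -/

section Words

variable {S : Type*}

/-- The sequence that begins with the word `w` and continues with the constant letter `z`. -/
def extend (z : S) {n : ℕ} (w : Fin n → S) : ℕ → S := fun i => if h : i < n then w ⟨i, h⟩ else z

lemma prepend_extend (z a : S) {n : ℕ} (w : Fin n → S) :
    prepend a (extend z w) = extend z (Fin.cons a w : Fin (n + 1) → S) := by
  funext i
  cases i with
  | zero => simp [extend]
  | succ i =>
    by_cases h : i < n
    · simp only [prepend_succ, extend, dif_pos h, dif_pos (Nat.succ_lt_succ h)]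
      exact (Fin.cons_succ (α := fun _ => S) a w ⟨i, h⟩).symm
    · simp [extend, h]

lemma extend_apply_of_lt (z : S) {n : ℕ} (x : ℕ → S) {i : ℕ} (hi : i < n) :
    extend z (fun j : Fin n => x j) i = x i := by
  simp [extend, hi]

lemma mem_cylinder_iff {n : ℕ} {w : Fin n → S} {x : ℕ → S} :
    x ∈ cylinder w ↔ (fun i : Fin n => x i) = w :=
  funext_iff.symm

lemma prepend_mem_cylinder_cons {n : ℕ} {a b : S} {w : Fin n → S} {x : ℕ → S} :
    prepend b x ∈ cylinder (Fin.cons a w : Fin (n + 1) → S) ↔ b = a ∧ x ∈ cylinder w := by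
  simp [cylinder, Fin.forall_fin_succ]

lemma mem_cylinder_cons {n : ℕ} {a : S} {w : Fin n → S} {x : ℕ → S} :
    x ∈ cylinder (Fin.cons a w : Fin (n + 1) → S) ↔ x 0 = a ∧ shift x ∈ cylinder w := by
  rw [← prepend_mem_cylinder_cons, prepend_shift]

lemma disjoint_cylinder {n : ℕ} {v w : Fin n → S} (h : v ≠ w) :
    Disjoint (cylinder v) (cylinder w) :=
  Set.disjoint_left.2 fun _ hv hw => h ((mem_cylinder_iff.1 hv).symm.trans (mem_cylinder_iff.1 hw))

lemma iUnion_cylinder (n : ℕ) : ⋃ w : Fin n → S, cylinder w = Set.univ :=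
  Set.eq_univ_of_forall fun x => Set.mem_iUnion.2 ⟨fun i => x i, fun _ => rfl⟩

lemma sum_fin_succ_eq_sum_cons [Fintype S] {n : ℕ} (F : (Fin (n + 1) → S) → ℝ) :
    ∑ v, F v = ∑ w : Fin n → S, ∑ a : S, F (Fin.cons a w) := by
  rw [Finset.sum_comm, ← Fintype.sum_prod_type', ← (Fin.consEquiv fun _ => S).sum_comp]
  rfl

end Words

lemma blockEntropy_nonneg {S : Type*} [Fintype S] [MeasurableSpace S] (μ : Measure (ℕ → S))
    [IsProbabilityMeasure μ] (n : ℕ) : 0 ≤ blockEntropy μ n :=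
  Finset.sum_nonneg fun _ _ => Real.negMulLog_nonneg measureReal_nonneg measureReal_le_one

/-! ### Block entropies and the lower bound on free energy -/

section Cylinders

variable {S : Type*} [Fintype S] [TopologicalSpace S] [DiscreteTopology S] [MeasurableSpace S]
  [BorelSpace S]

lemma measurableSet_cylinder {n : ℕ} (w : Fin n → S) : MeasurableSet (cylinder w) :=
  (isClopen_cylinder w).isClosed.measurableSet

variable {μ : Measure (ℕ → S)} {p : (ℕ → S) → ℝ}

lemma sum_setIntegral_cylinder {f : (ℕ → S) → ℝ} (hf : Integrable f μ) (n : ℕ) :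
    ∑ w : Fin n → S, ∫ x in cylinder w, f x ∂μ = ∫ x, f x ∂μ := by
  rw [← integral_iUnion_fintype measurableSet_cylinder (fun v w h => disjoint_cylinder h)
    (fun _ => hf.integrableOn), iUnion_cylinder, setIntegral_univ]

/-- Duality tested on the indicator of the cylinder, which is continuous because cylinders are
clopen. -/
lemma IsTransferInvariant.measureReal_cylinder_cons (hμ : IsTransferInvariant p μ) {n : ℕ} (a : S)
    (w : Fin n → S) :
    μ.real (cylinder (Fin.cons a w : Fin (n + 1) → S))
      = ∫ x in cylinder w, Real.exp (p (prepend a x)) ∂μ := by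
  classical
  have hc : Continuous ((cylinder (Fin.cons a w : Fin (n + 1) → S)).indicator fun _ => (1 : ℝ)) :=
    (isClopen_cylinder _).continuous_indicator continuous_const
  have h := hμ _ hc
  rw [integral_indicator (measurableSet_cylinder _), setIntegral_const, smul_eq_mul, mul_one] at h
  rw [← h, ← integral_indicator (measurableSet_cylinder _)]
  refine integral_congr_ae (Eventually.of_forall fun x => ?_)
  simp only [transfer, Set.indicator_apply, prepend_mem_cylinder_cons]
  by_cases hx : x ∈ cylinder w <;> simp [hx]

variable [IsProbabilityMeasure μ]

lemma sum_measureReal_cylinder (n : ℕ) : ∑ w : Fin n → S, μ.real (cylinder w) = 1 := by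
  simpa using sum_setIntegral_cylinder (μ := μ) (integrable_const (1 : ℝ)) n

lemma integral_comp_word {n : ℕ} (F : (Fin n → S) → ℝ) :
    ∫ x, F (fun i => x i) ∂μ = ∑ w, μ.real (cylinder w) * F w := by
  have hF : Continuous fun x : ℕ → S => F fun i => x i :=
    continuous_of_discreteTopology.comp (continuous_pi fun i => continuous_apply (i : ℕ))
  rw [← sum_setIntegral_cylinder (integrable_of_continuous hF) n]
  refine Finset.sum_congr rfl fun w _ => ?_
  rw [setIntegral_congr_fun (g := fun _ => F w) (measurableSet_cylinder w)
    fun x hx => congrArg F (mem_cylinder_iff.1 hx), setIntegral_const, smul_eq_mul]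

lemma sum_measureReal_cylinder_cons (hμ : MeasurePreserving shift μ μ) {n : ℕ} (w : Fin n → S) :
    ∑ a : S, μ.real (cylinder (Fin.cons a w : Fin (n + 1) → S)) = μ.real (cylinder w) := by
  rw [← hμ.measureReal_preimage (measurableSet_cylinder w).nullMeasurableSet]
  have : shift ⁻¹' cylinder w = ⋃ a ∈ (Finset.univ : Finset S),
      cylinder (Fin.cons a w : Fin (n + 1) → S) := by
    ext x
    simp [mem_cylinder_cons]
  rw [this, measureReal_biUnion_finset]
  · intro a _ b _ hab
    exact disjoint_cylinder fun h => hab (by simpa using congrFun h 0)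
  · exact fun a _ => measurableSet_cylinder _

lemma measureReal_cylinder_cons_le (hμ : MeasurePreserving shift μ μ) {n : ℕ} (a : S)
    (w : Fin n → S) :
    μ.real (cylinder (Fin.cons a w : Fin (n + 1) → S)) ≤ μ.real (cylinder w) := by
  rw [← sum_measureReal_cylinder_cons hμ w]
  exact Finset.single_le_sum (f := fun a => μ.real (cylinder (Fin.cons a w : Fin (n + 1) → S)))
    (fun _ _ => measureReal_nonneg) (Finset.mem_univ a)

lemma blockEntropy_zero : blockEntropy μ 0 = 0 := by
  have h : μ.real (cylinder (default : Fin 0 → S)) = 1 := by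
    simpa using sum_measureReal_cylinder (μ := μ) 0
  simp [blockEntropy, h]

/-- Chain rule: the added sum is the entropy of the first letter given the next `n`. Shift
invariance makes those `n` letters carry entropy `Hₙ`. -/
lemma blockEntropy_succ (hμ : MeasurePreserving shift μ μ) (n : ℕ) :
    blockEntropy μ (n + 1) = blockEntropy μ n
      + ∑ w : Fin n → S, ∑ a : S,
        (Real.negMulLog (μ.real (cylinder (Fin.cons a w : Fin (n + 1) → S)))
          + μ.real (cylinder (Fin.cons a w : Fin (n + 1) → S)) * Real.log (μ.real (cylinder w))) := by
  rw [blockEntropy, blockEntropy, sum_fin_succ_eq_sum_cons, ← Finset.sum_add_distrib]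
  refine Finset.sum_congr rfl fun w _ => ?_
  rw [Finset.sum_add_distrib, ← Finset.sum_mul, sum_measureReal_cylinder_cons hμ w, Real.negMulLog]
  ring

lemma mul_negMulLog_div {P Q : ℝ} (hQ : 0 < Q) :
    Q * Real.negMulLog (P / Q) = Real.negMulLog P + P * Real.log Q := by
  rcases eq_or_ne P 0 with rfl | hP
  · simp
  · rw [Real.negMulLog, Real.negMulLog, Real.log_div hP hQ.ne']
    field_simp
    ring

/-- By duality `-∫ p` is the mean entropy of the letter distribution `exp (p (a x))`. Averaging that
distribution over a cylinder can only raise entropy, by Jensen for the concave `Real.negMulLog`, and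
yields the conditional entropy. -/
lemma IsTransferInvariant.neg_integral_le_blockEntropy_sub (hp : Continuous p)
    (hμ : IsTransferInvariant p μ) (hμ' : MeasurePreserving shift μ μ) (n : ℕ) :
    -∫ x, p x ∂μ ≤ blockEntropy μ (n + 1) - blockEntropy μ n := by
  have hexp (a : S) : Continuous fun x => Real.exp (p (prepend a x)) :=
    Real.continuous_exp.comp (hp.comp (continuous_prepend a))
  have hneg (a : S) : Continuous fun x => Real.negMulLog (Real.exp (p (prepend a x))) :=
    Real.continuous_negMulLog.comp (hexp a)
  rw [blockEntropy_succ hμ', add_sub_cancel_left]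
  have e : -∫ x, p x ∂μ = ∑ w : Fin n → S, ∑ a : S,
      ∫ x in cylinder w, Real.negMulLog (Real.exp (p (prepend a x))) ∂μ := by
    rw [← hμ p hp, ← integral_neg, ← sum_setIntegral_cylinder (f := fun x => -transfer p p x)
      (integrable_of_continuous (transfer_continuous hp hp).neg) n]
    refine Finset.sum_congr rfl fun w _ => ?_
    rw [← integral_finsetSum _ fun a _ => (integrable_of_continuous (hneg a)).integrableOn]
    refine integral_congr_ae (Eventually.of_forall fun x => ?_)
    simp [transfer, Real.negMulLog]
  rw [e]
  refine Finset.sum_le_sum fun w _ => Finset.sum_le_sum fun a _ => ?_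
  rcases (measureReal_nonneg : 0 ≤ μ.real (cylinder w)).eq_or_lt with h0 | hpos
  · have h0' : μ (cylinder w) = 0 := by
      rw [eq_comm, measureReal_eq_zero_iff] at h0
      exact h0
    have h1 : μ.real (cylinder (Fin.cons a w : Fin (n + 1) → S)) = 0 :=
      le_antisymm (h0 ▸ measureReal_cylinder_cons_le hμ' a w) measureReal_nonneg
    rw [setIntegral_measure_zero _ h0', h1]
    simp
  · have hne : μ (cylinder w) ≠ 0 := fun h => by simp [measureReal_def, h] at hpos
    have hJ := Real.concaveOn_negMulLog.le_map_set_average Real.continuous_negMulLog.continuousOn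
      isClosed_Ici hne (measure_ne_top μ _)
      (Eventually.of_forall fun x => Real.exp_nonneg (p (prepend a x)))
      (integrable_of_continuous (hexp a)).integrableOn
      (integrable_of_continuous (hneg a)).integrableOn
    rw [setAverage_eq, setAverage_eq, ← hμ.measureReal_cylinder_cons, smul_eq_mul, smul_eq_mul,
      inv_mul_eq_div, inv_mul_eq_div, div_le_iff₀ hpos, mul_comm, mul_negMulLog_div hpos] at hJ
    exact hJ

lemma IsTransferInvariant.entropy_add_integral_nonneg (hp : Continuous p)
    (hμ : IsTransferInvariant p μ) (hμ' : MeasurePreserving shift μ μ) :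
    0 ≤ entropy μ + ∫ x, p x ∂μ := by
  have h (n : ℕ) : n * -∫ x, p x ∂μ ≤ blockEntropy μ n := by
    induction n with
    | zero => simp [blockEntropy_zero]
    | succ n ih =>
      have := hμ.neg_integral_le_blockEntropy_sub hp hμ' n
      push_cast
      linarith
  have : -∫ x, p x ∂μ ≤ entropy μ := le_ciInf fun n => by
    rw [le_div_iff₀ (by positivity), mul_comm]
    exact_mod_cast h (n + 1)
  linarith

end Cylinders

/-! ### Existence of a fixed point of the dual transfer operator -/

section Existence

variable {S : Type*} [Fintype S]

/-- The transfer operator as a linear map. -/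
noncomputable def transferLinearMap (p : (ℕ → S) → ℝ) :
    ((ℕ → S) → ℝ) →ₗ[ℝ] ((ℕ → S) → ℝ) where
  toFun := transfer p
  map_add' := transfer_add p
  map_smul' := transfer_const_mul p

variable {p : (ℕ → S) → ℝ}

lemma transferLinearMap_pow_mono {f g : (ℕ → S) → ℝ} (h : ∀ x, f x ≤ g x) (k : ℕ) (x : ℕ → S) :
    (transferLinearMap p ^ k) f x ≤ (transferLinearMap p ^ k) g x := by
  induction k generalizing x with
  | zero => exact h x
  | succ k ih =>
    rw [pow_succ']
    exact transfer_mono ih x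

lemma transferLinearMap_pow_const (hnorm : IsNormalized p) (c : ℝ) (k : ℕ) :
    (transferLinearMap p ^ k) (fun _ => c) = fun _ => c := by
  induction k with
  | zero => rfl
  | succ k ih =>
    rw [pow_succ', Module.End.mul_apply, ih]
    exact transfer_const hnorm c

/-- The averages of `𝓛ᵏ f (x)` over `k ≤ n`. -/
noncomputable def transferAverage (p : (ℕ → S) → ℝ) (x : ℕ → S) (n : ℕ) (f : (ℕ → S) → ℝ) : ℝ :=
  (∑ k ∈ Finset.range (n + 1), (transferLinearMap p ^ k) f x) / ((n : ℝ) + 1)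

lemma transferAverage_mono {f g : (ℕ → S) → ℝ} (h : ∀ x, f x ≤ g x) (x : ℕ → S) (n : ℕ) :
    transferAverage p x n f ≤ transferAverage p x n g :=
  div_le_div_of_nonneg_right
    (Finset.sum_le_sum fun k _ => transferLinearMap_pow_mono h k x) (by positivity)

lemma transferAverage_const (hnorm : IsNormalized p) (x : ℕ → S) (n : ℕ) (c : ℝ) :
    transferAverage p x n (fun _ => c) = c := by
  simp only [transferAverage, transferLinearMap_pow_const hnorm, Finset.sum_const,
    Finset.card_range, nsmul_eq_mul, Nat.cast_add, Nat.cast_one]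
  exact mul_div_cancel_left₀ c (by positivity)

lemma transferAverage_add (x : ℕ → S) (n : ℕ) (f g : (ℕ → S) → ℝ) :
    transferAverage p x n (f + g) = transferAverage p x n f + transferAverage p x n g := by
  simp only [transferAverage, map_add, Pi.add_apply, Finset.sum_add_distrib, add_div]

lemma transferAverage_smul (x : ℕ → S) (n : ℕ) (c : ℝ) (f : (ℕ → S) → ℝ) :
    transferAverage p x n (c • f) = c * transferAverage p x n f := by
  simp only [transferAverage, map_smul, Pi.smul_apply, smul_eq_mul, ← Finset.mul_sum, mul_div_assoc]

lemma abs_transferAverage_le (hnorm : IsNormalized p) {f : (ℕ → S) → ℝ} {C : ℝ}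
    (hC : ∀ x, |f x| ≤ C) (x : ℕ → S) (n : ℕ) : |transferAverage p x n f| ≤ C := by
  rw [abs_le, ← transferAverage_const hnorm x n C, ← transferAverage_const hnorm x n (-_)]
  rw [transferAverage_const hnorm x n C]
  exact ⟨transferAverage_mono (fun y => (abs_le.1 (hC y)).1) x n,
    (transferAverage_mono (fun y => (abs_le.1 (hC y)).2) x n).trans_eq
      (transferAverage_const hnorm x n C)⟩

lemma transferAverage_transfer_sub (x : ℕ → S) (n : ℕ) (f : (ℕ → S) → ℝ) :
    transferAverage p x n (transfer p f) - transferAverage p x n f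
      = ((transferLinearMap p ^ (n + 1)) f x - f x) / ((n : ℝ) + 1) := by
  have h (k : ℕ) : (transferLinearMap p ^ k) (transfer p f) = (transferLinearMap p ^ (k + 1)) f := by
    rw [pow_succ]
    rfl
  simp only [transferAverage, h]
  rw [← sub_div, ← Finset.sum_sub_distrib,
    Finset.sum_range_sub fun k => (transferLinearMap p ^ k) f x]
  simp

variable [TopologicalSpace S]

lemma exists_abs_le_of_continuous {f : (ℕ → S) → ℝ} (hf : Continuous f) : ∃ C, ∀ x, |f x| ≤ C := by
  obtain ⟨C, hC⟩ := isCompact_univ.exists_bound_of_continuousOn hf.continuousOn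
  exact ⟨C, fun x => hC x trivial⟩

lemma exists_tendsto_transferAverage (hnorm : IsNormalized p) (x : ℕ → S) {f : (ℕ → S) → ℝ}
    (hf : Continuous f) :
    ∃ l, Tendsto (fun n => transferAverage p x n f) (hyperfilter ℕ : Filter ℕ) (𝓝 l) := by
  obtain ⟨C, hC⟩ := exists_abs_le_of_continuous hf
  obtain ⟨l, -, hl⟩ := isCompact_Icc.ultrafilter_le_nhds
    ((hyperfilter ℕ).map fun n => transferAverage p x n f) (s := Set.Icc (-C) C) (by
      rw [le_principal_iff]
      exact Eventually.of_forall (f := (hyperfilter ℕ : Filter ℕ)) fun n => abs_le.1 (abs_transferAverage_le hnorm hC x n))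
  exact ⟨l, hl⟩

lemma tendsto_transferAverage_transfer_sub (hnorm : IsNormalized p) (x : ℕ → S)
    {f : (ℕ → S) → ℝ} (hf : Continuous f) :
    Tendsto (fun n => transferAverage p x n (transfer p f) - transferAverage p x n f)
      atTop (𝓝 0) := by
  obtain ⟨C, hC⟩ := exists_abs_le_of_continuous hf
  refine squeeze_zero_norm (a := fun n : ℕ => (2 * C) * (1 / ((n : ℝ) + 1))) (fun n => ?_) ?_
  · rw [transferAverage_transfer_sub, Real.norm_eq_abs, abs_div,
      abs_of_pos (by positivity : (0 : ℝ) < n + 1), mul_one_div]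
    gcongr
    have h1 : (transferLinearMap p ^ (n + 1)) f x ≤ C := by
      have := transferLinearMap_pow_mono (p := p) (fun y => (abs_le.1 (hC y)).2) (n + 1) x
      rwa [transferLinearMap_pow_const hnorm] at this
    have h2 : -C ≤ (transferLinearMap p ^ (n + 1)) f x := by
      have := transferLinearMap_pow_mono (p := p) (fun y => (abs_le.1 (hC y)).1) (n + 1) x
      rwa [transferLinearMap_pow_const hnorm] at this
    have h3 := abs_le.1 (hC x)
    rw [abs_le]
    constructor <;> linarith [h3.1, h3.2]
  · simpa using tendsto_one_div_add_atTop_nhds_zero_nat.const_mul (2 * C)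

variable [DiscreteTopology S] [MeasurableSpace S] [BorelSpace S]

/-- Normalization gives `𝓛 (f ∘ σ) = f`, so duality for `f ∘ σ` is shift invariance. -/
lemma IsTransferInvariant.measurePreserving_shift {μ : Measure (ℕ → S)} [IsFiniteMeasure μ]
    (hnorm : IsNormalized p) (hμ : IsTransferInvariant p μ) : MeasurePreserving shift μ μ := by
  refine ⟨continuous_shift.measurable, ext_of_forall_integral_eq_of_IsFiniteMeasure fun f => ?_⟩
  rw [integral_map continuous_shift.measurable.aemeasurable
    f.continuous.measurable.aestronglyMeasurable]
  have h := hμ _ (f.continuous.comp continuous_shift)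
  refine h.symm.trans ?_
  exact congrArg (fun F => ∫ x, F x ∂μ) (transfer_comp_shift hnorm f)

/-- Cesàro averages of `𝓛ᵏ f (x)` converge along a free ultrafilter for all `f` at once; the limit
is a positive functional, so Riesz–Markov–Kakutani represents it. Replacing `f` by `𝓛 f` telescopes
to a difference that vanishes in the limit. -/
lemma exists_isTransferInvariant [Nonempty S] (hp : Continuous p) (hnorm : IsNormalized p) :
    ∃ ν : Measure (ℕ → S), IsProbabilityMeasure ν ∧ IsTransferInvariant p ν := by
  obtain ⟨a⟩ := ‹Nonempty S›
  let x : ℕ → S := fun _ => a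
  choose Λ hΛ using fun g : C_c((ℕ → S), ℝ) => exists_tendsto_transferAverage hnorm x g.continuous
  let Λ' : C_c((ℕ → S), ℝ) →ₚ[ℝ] ℝ :=
    { toFun := Λ
      map_add' := fun g g' => tendsto_nhds_unique (hΛ (g + g'))
        (by
          have := (hΛ g).add (hΛ g')
          simp_rw [← transferAverage_add] at this
          exact this)
      map_smul' := fun c g => tendsto_nhds_unique (hΛ (c • g))
        (by
          have := (hΛ g).const_mul c
          simp_rw [← transferAverage_smul] at this
          exact this)
      monotone' := fun g g' h => le_of_tendsto_of_tendsto' (hΛ g) (hΛ g')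
        fun n => transferAverage_mono h x n }
  let ν := RealRMK.rieszMeasure Λ'
  have hν {f : (ℕ → S) → ℝ} (hf : Continuous f) :
      Tendsto (fun n => transferAverage p x n f) (hyperfilter ℕ : Filter ℕ) (𝓝 (∫ y, f y ∂ν)) := by
    let g : C_c((ℕ → S), ℝ) := ⟨⟨f, hf⟩, .of_compactSpace f⟩
    have : ∫ y, f y ∂ν = Λ g := RealRMK.integral_rieszMeasure Λ' g
    rw [this]
    exact hΛ g
  refine ⟨ν, ⟨?_⟩, fun f hf => ?_⟩
  · have h := tendsto_nhds_unique (hν (continuous_const (y := (1 : ℝ))))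
      (tendsto_const_nhds.congr fun n => (transferAverage_const hnorm x n 1).symm)
    rw [integral_const, smul_eq_mul, mul_one, measureReal_def, ENNReal.toReal_eq_one_iff] at h
    exact h
  · have h := (hν (transfer_continuous hp hf)).sub (hν hf)
    have h0 := (tendsto_transferAverage_transfer_sub hnorm x hf).mono_left
      Nat.hyperfilter_le_atTop
    exact sub_eq_zero.1 (tendsto_nhds_unique h h0)

end Existence

/-! ### Relative entropy, Hellinger distance and total variation -/

section Hellinger

variable {ι : Type*} [Fintype ι] {P R : ι → ℝ}

/-- Apply `log x ≤ x - 1` to `x = √(R / P)`, not to `R / P`: this leaves `2 √(P R) - 2 P`, which is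
`-(√P - √R)² + R - P`. -/
lemma sum_mul_log_div_le (hP : ∀ i, 0 ≤ P i) (hR : ∀ i, 0 ≤ R i) (hPR : ∀ i, R i = 0 → P i = 0)
    (hP1 : ∑ i, P i = 1) (hR1 : ∑ i, R i = 1) :
    ∑ i, P i * Real.log (R i / P i) ≤ -∑ i, (√(P i) - √(R i)) ^ 2 := by
  have h (i : ι) : P i * Real.log (R i / P i) ≤ -(√(P i) - √(R i)) ^ 2 + R i - P i := by
    have e1 := Real.sq_sqrt (hP i)
    have e2 := Real.sq_sqrt (hR i)
    rcases (hP i).eq_or_lt with h0 | hpos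
    · rw [← h0] at e1 ⊢
      simp only [zero_mul, Real.sqrt_zero]
      nlinarith
    · have hRpos : 0 < R i := (hR i).lt_of_ne fun h => hpos.ne' (hPR i h.symm)
      have hsP := Real.sqrt_pos.2 hpos
      have hsR := Real.sqrt_pos.2 hRpos
      have hlog : Real.log (R i / P i) = 2 * Real.log (√(R i) / √(P i)) := by
        rw [← Real.sqrt_div' _ hpos.le, Real.log_sqrt (div_nonneg hRpos.le hpos.le)]
        ring
      have hle := Real.log_le_sub_one_of_pos (div_pos hsR hsP)
      have hmul : P i * (√(R i) / √(P i)) = √(P i) * √(R i) := by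
        nth_rw 1 [← e1]
        field_simp
      rw [hlog]
      nlinarith [mul_le_mul_of_nonneg_left hle hpos.le]
  calc ∑ i, P i * Real.log (R i / P i) ≤ ∑ i, (-(√(P i) - √(R i)) ^ 2 + R i - P i) :=
        Finset.sum_le_sum fun i _ => h i
    _ = -∑ i, (√(P i) - √(R i)) ^ 2 := by
      rw [Finset.sum_sub_distrib, Finset.sum_add_distrib, hP1, hR1, Finset.sum_neg_distrib]
      ring

/-- Cauchy–Schwarz for `P - R = (√P - √R) (√P + √R)`. -/
lemma sum_abs_sub_le (hP : ∀ i, 0 ≤ P i) (hR : ∀ i, 0 ≤ R i)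
    (hP1 : ∑ i, P i = 1) (hR1 : ∑ i, R i = 1) :
    ∑ i, |P i - R i| ≤ 2 * √(∑ i, (√(P i) - √(R i)) ^ 2) := by
  have h4 : ∑ i, (√(P i) + √(R i)) ^ 2 ≤ 2 ^ 2 := by
    calc ∑ i, (√(P i) + √(R i)) ^ 2 ≤ ∑ i, (2 * P i + 2 * R i) :=
          Finset.sum_le_sum fun i _ => by
            nlinarith [Real.sq_sqrt (hP i), Real.sq_sqrt (hR i), sq_nonneg (√(P i) - √(R i))]
      _ = 2 ^ 2 := by
        rw [Finset.sum_add_distrib, ← Finset.mul_sum, ← Finset.mul_sum, hP1, hR1]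
        norm_num
  calc ∑ i, |P i - R i| = ∑ i, |√(P i) - √(R i)| * (√(P i) + √(R i)) :=
        Finset.sum_congr rfl fun i _ => by
          have hs := add_nonneg (Real.sqrt_nonneg (P i)) (Real.sqrt_nonneg (R i))
          nth_rw 1 [← abs_of_nonneg hs]
          rw [← abs_mul]
          congr 1
          nlinarith [Real.sq_sqrt (hP i), Real.sq_sqrt (hR i)]
    _ ≤ √(∑ i, |√(P i) - √(R i)| ^ 2) * √(∑ i, (√(P i) + √(R i)) ^ 2) :=
      Real.sum_mul_le_sqrt_mul_sqrt _ _ _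
    _ ≤ √(∑ i, (√(P i) - √(R i)) ^ 2) * 2 := by
      simp only [sq_abs]
      gcongr
      exact Real.sqrt_le_iff.2 ⟨by norm_num, h4⟩
    _ = _ := mul_comm _ _

end Hellinger

lemma continuous_extend_word {S : Type*} [TopologicalSpace S] (z : S) (n : ℕ) :
    Continuous fun x : ℕ → S => extend z fun i : Fin n => x i := by
  refine continuous_pi fun i => ?_
  by_cases h : i < n
  · simpa [extend, h] using continuous_apply i
  · simpa [extend, h] using continuous_const

/-! ### Equilibrium states are fixed by the dual operator -/

section Equilibrium

variable {S : Type*} [MeasurableSpace S]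

/-- The mass of the cylinder of `v` if its first letter were drawn, given the others, from the
kernel `exp p` evaluated at the extension of `v` by the letter `z`. -/
noncomputable def kernelMass (p : (ℕ → S) → ℝ) (μ : Measure (ℕ → S)) (z : S) {n : ℕ}
    (v : Fin (n + 1) → S) : ℝ :=
  μ.real (cylinder (Fin.tail v)) * Real.exp (p (extend z v))

lemma kernelMass_nonneg (p : (ℕ → S) → ℝ) (μ : Measure (ℕ → S)) (z : S) {n : ℕ}
    (v : Fin (n + 1) → S) : 0 ≤ kernelMass p μ z v :=
  mul_nonneg measureReal_nonneg (Real.exp_nonneg _)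

variable [Fintype S]

/-- The squared Hellinger distance between the cylinder masses and `kernelMass`. -/
noncomputable def hellingerDefect (p : (ℕ → S) → ℝ) (μ : Measure (ℕ → S)) (z : S) (n : ℕ) : ℝ :=
  ∑ v : Fin (n + 1) → S, (√(μ.real (cylinder v)) - √(kernelMass p μ z v)) ^ 2

lemma hellingerDefect_nonneg (p : (ℕ → S) → ℝ) (μ : Measure (ℕ → S)) (z : S) (n : ℕ) :
    0 ≤ hellingerDefect p μ z n :=
  Finset.sum_nonneg fun _ _ => sq_nonneg _

lemma sum_kernelMass_mul (p : (ℕ → S) → ℝ) (μ : Measure (ℕ → S)) (z : S) (n : ℕ)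
    (f : (ℕ → S) → ℝ) :
    ∑ v : Fin (n + 1) → S, kernelMass p μ z v * f (extend z v)
      = ∑ w : Fin n → S, μ.real (cylinder w) * transfer p f (extend z w) := by
  rw [sum_fin_succ_eq_sum_cons]
  simp only [kernelMass, Fin.tail_cons, transfer, prepend_extend, Finset.mul_sum, mul_assoc]

variable [TopologicalSpace S] [DiscreteTopology S] [BorelSpace S]
  {μ : Measure (ℕ → S)} [IsProbabilityMeasure μ] {p : (ℕ → S) → ℝ}

lemma sum_kernelMass (hnorm : IsNormalized p) (z : S) (n : ℕ) :
    ∑ v : Fin (n + 1) → S, kernelMass p μ z v = 1 := by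
  have h := sum_kernelMass_mul p μ z n fun _ => 1
  simpa [transfer_const hnorm, sum_measureReal_cylinder] using h

lemma measureReal_cylinder_le_tail (hμ : MeasurePreserving shift μ μ) {n : ℕ}
    (v : Fin (n + 1) → S) : μ.real (cylinder v) ≤ μ.real (cylinder (Fin.tail v)) := by
  conv_lhs => rw [← Fin.cons_self_tail v]
  exact measureReal_cylinder_cons_le hμ _ _

/-- By the chain rule, the left side minus `Hₙ` is minus the relative entropy of the cylinder masses
with respect to `kernelMass`. -/
lemma blockEntropy_succ_add_sum_le (hnorm : IsNormalized p) (hμ : MeasurePreserving shift μ μ)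
    (z : S) (n : ℕ) :
    blockEntropy μ (n + 1) + ∑ v : Fin (n + 1) → S, μ.real (cylinder v) * p (extend z v)
      ≤ blockEntropy μ n - hellingerDefect p μ z n := by
  have hsplit : ∑ w : Fin n → S, ∑ a : S,
        (Real.negMulLog (μ.real (cylinder (Fin.cons a w : Fin (n + 1) → S)))
          + μ.real (cylinder (Fin.cons a w : Fin (n + 1) → S)) * Real.log (μ.real (cylinder w)))
      = ∑ v : Fin (n + 1) → S, (Real.negMulLog (μ.real (cylinder v))
          + μ.real (cylinder v) * Real.log (μ.real (cylinder (Fin.tail v)))) := by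
    rw [sum_fin_succ_eq_sum_cons]
    simp only [Fin.tail_cons]
  have hzero (v : Fin (n + 1) → S) (h : kernelMass p μ z v = 0) : μ.real (cylinder v) = 0 := by
    have : μ.real (cylinder (Fin.tail v)) = 0 := by
      simpa [kernelMass, Real.exp_ne_zero] using h
    exact le_antisymm (this ▸ measureReal_cylinder_le_tail hμ v) measureReal_nonneg
  have hle := sum_mul_log_div_le (P := fun v : Fin (n + 1) → S => μ.real (cylinder v))
    (R := kernelMass p μ z) (fun _ => measureReal_nonneg) (kernelMass_nonneg p μ z) hzero
    (sum_measureReal_cylinder _) (sum_kernelMass hnorm z n)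
  have e (v : Fin (n + 1) → S) :
      Real.negMulLog (μ.real (cylinder v))
          + μ.real (cylinder v) * Real.log (μ.real (cylinder (Fin.tail v)))
          + μ.real (cylinder v) * p (extend z v)
        = μ.real (cylinder v) * Real.log (kernelMass p μ z v / μ.real (cylinder v)) := by
    rcases (measureReal_nonneg : 0 ≤ μ.real (cylinder v)).eq_or_lt with h0 | hpos
    · simp [← h0]
    · have hQ := hpos.trans_le (measureReal_cylinder_le_tail hμ v)
      rw [kernelMass, Real.log_div (mul_pos hQ (Real.exp_pos _)).ne' hpos.ne',
        Real.log_mul hQ.ne' (Real.exp_ne_zero _), Real.log_exp, Real.negMulLog]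
      ring
  rw [blockEntropy_succ hμ, hsplit, add_assoc, ← Finset.sum_add_distrib,
    Finset.sum_congr rfl fun v _ => e v, sub_eq_add_neg]
  exact add_le_add_right hle _

lemma tendsto_integral_extend_word {f : (ℕ → S) → ℝ} (hf : Continuous f) (z : S) :
    Tendsto (fun n => ∑ w : Fin n → S, μ.real (cylinder w) * f (extend z w)) atTop
      (𝓝 (∫ x, f x ∂μ)) := by
  obtain ⟨C, hC⟩ := exists_abs_le_of_continuous hf
  have h : Tendsto (fun n => ∫ x, f (extend z fun i : Fin n => x i) ∂μ) atTop
      (𝓝 (∫ x, f x ∂μ)) := by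
    refine tendsto_integral_of_dominated_convergence (fun _ => C) (fun n =>
      (hf.comp (continuous_extend_word z n)).measurable.aestronglyMeasurable)
      (integrable_const C) (fun n => Eventually.of_forall fun x => hC _)
      (Eventually.of_forall fun x => (hf.tendsto x).comp (tendsto_pi_nhds.2 fun i => ?_))
    refine tendsto_const_nhds.congr' ?_
    filter_upwards [eventually_gt_atTop i] with n hn
    exact (extend_apply_of_lt z x hn).symm
  exact h.congr fun n => integral_comp_word (μ := μ) fun w : Fin n → S => f (extend z w)

lemma integral_sub_le_sum_extend {θ L : ℝ} (hθ : θ ∈ Set.Ioo (0 : ℝ) 1)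
    (hp : IsLipschitzBound θ p L) (z : S) (n : ℕ) :
    ∫ x, p x ∂μ - L * θ ^ n ≤ ∑ w : Fin n → S, μ.real (cylinder w) * p (extend z w) := by
  rw [← integral_comp_word (μ := μ) fun w : Fin n → S => p (extend z w), sub_le_iff_le_add]
  have hc := hp.continuous hθ
  have hi : Integrable (fun x => p (extend z fun i : Fin n => x i)) μ :=
    integrable_of_continuous (hc.comp (continuous_extend_word z n))
  calc ∫ x, p x ∂μ ≤ ∫ x, (p (extend z fun i : Fin n => x i) + L * θ ^ n) ∂μ := by
        refine integral_mono (integrable_of_continuous hc) (hi.add (integrable_const _)) fun x => ?_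
        have h1 := (le_abs_self _).trans (hp.abs_sub_le x (extend z fun i : Fin n => x i))
        have h2 : shiftDist θ x (extend z fun i : Fin n => x i) ≤ θ ^ n :=
          shiftDist_le_pow hθ.1.le hθ.2.le fun i hi => (extend_apply_of_lt z x hi).symm
        have h3 := mul_le_mul_of_nonneg_left h2 (zero_le_one.trans hp.one_le)
        change p x ≤ p (extend z fun i : Fin n => x i) + L * θ ^ n
        linarith
    _ = _ := by
      rw [integral_add hi (integrable_const _)]
      simp

/-- A measure whose free energy is nonnegative has summable Hellinger defects. -/
lemma tendsto_hellingerDefect {θ L : ℝ} (hθ : θ ∈ Set.Ioo (0 : ℝ) 1)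
    (hp : IsLipschitzBound θ p L) (hnorm : IsNormalized p) (hμ : MeasurePreserving shift μ μ)
    (hfree : 0 ≤ entropy μ + ∫ x, p x ∂μ) (z : S) :
    Tendsto (hellingerDefect p μ z) atTop (𝓝 0) := by
  have hL : 0 ≤ L := zero_le_one.trans hp.one_le
  have hupper (n : ℕ) : blockEntropy μ n + n * ∫ x, p x ∂μ
      + ∑ k ∈ Finset.range n, hellingerDefect p μ z k ≤ L * ∑ k ∈ Finset.range n, θ ^ k := by
    induction n with
    | zero => simp [blockEntropy_zero]
    | succ n ih =>
      have h1 := blockEntropy_succ_add_sum_le (μ := μ) hnorm hμ z n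
      have h2 := integral_sub_le_sum_extend (μ := μ) hθ hp z (n + 1)
      have h3 : L * θ ^ (n + 1) ≤ L * θ ^ n := mul_le_mul_of_nonneg_left
        (pow_le_pow_of_le_one hθ.1.le hθ.2.le n.le_succ) hL
      rw [Finset.sum_range_succ, Finset.sum_range_succ]
      push_cast
      linarith
  -- Entropy is an infimum of `Hₙ / n`, so the sign of the free energy passes to every finite `n`.
  have hlower (n : ℕ) : 0 ≤ blockEntropy μ n + n * ∫ x, p x ∂μ := by
    cases n with
    | zero => simp [blockEntropy_zero]
    | succ n =>
      have hbdd : BddBelow (Set.range fun n : ℕ => blockEntropy μ (n + 1) / ((n : ℝ) + 1)) :=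
        ⟨0, by
          rintro _ ⟨k, rfl⟩
          exact div_nonneg (blockEntropy_nonneg μ _) (by positivity)⟩
      have h : entropy μ ≤ blockEntropy μ (n + 1) / ((n : ℝ) + 1) := ciInf_le hbdd n
      have hpos : (0 : ℝ) < n + 1 := by positivity
      rw [le_div_iff₀ hpos] at h
      push_cast
      nlinarith [mul_nonneg hfree hpos.le]
  have hsum : Summable (hellingerDefect p μ z) := by
    refine summable_of_sum_range_le (c := L * (1 - θ)⁻¹) (hellingerDefect_nonneg p μ z) fun n => ?_
    have hgeom := mul_le_mul_of_nonneg_left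
      ((summable_geometric_of_lt_one hθ.1.le hθ.2).sum_le_tsum (Finset.range n)
        fun k _ => pow_nonneg hθ.1.le k) hL
    rw [tsum_geometric_of_lt_one hθ.1.le hθ.2] at hgeom
    linarith [hupper n, hlower n]
  exact hsum.tendsto_atTop_zero

/-- Evaluated on words, `∫ 𝓛 f - ∫ f` is a limit of sums of `f` against `kernelMass` minus the
cylinder mass. The total variation of that difference is at most twice the root of the Hellinger
defect, which tends to zero. -/
lemma isTransferInvariant_of_free_energy_nonneg {θ L : ℝ} (hθ : θ ∈ Set.Ioo (0 : ℝ) 1)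
    (hp : IsLipschitzBound θ p L) (hnorm : IsNormalized p) (hμ : MeasurePreserving shift μ μ)
    (hfree : 0 ≤ entropy μ + ∫ x, p x ∂μ) : IsTransferInvariant p μ := by
  intro f hf
  obtain ⟨x₀⟩ : Nonempty (ℕ → S) := μ.nonempty_of_neZero
  set z := x₀ 0
  obtain ⟨C, hC⟩ := exists_abs_le_of_continuous hf
  have hC0 : 0 ≤ C := (abs_nonneg _).trans (hC x₀)
  have h1 := (tendsto_integral_extend_word (μ := μ) hf z).comp (tendsto_add_atTop_nat 1)
  have h2 := tendsto_integral_extend_word (μ := μ) (transfer_continuous (hp.continuous hθ) hf) z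
  have hbound : Tendsto (fun n => C * (2 * √(hellingerDefect p μ z n))) atTop (𝓝 0) := by
    have := (Real.continuous_sqrt.tendsto 0).comp (tendsto_hellingerDefect hθ hp hnorm hμ hfree z)
    simpa using (this.const_mul 2).const_mul C
  refine sub_eq_zero.1 (tendsto_nhds_unique (h2.sub h1) (squeeze_zero_norm (fun n => ?_) hbound))
  rw [← sum_kernelMass_mul, Function.comp_apply, ← Finset.sum_sub_distrib, Real.norm_eq_abs]
  calc |∑ v : Fin (n + 1) → S, (kernelMass p μ z v * f (extend z v)
          - μ.real (cylinder v) * f (extend z v))|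
      ≤ ∑ v : Fin (n + 1) → S, |kernelMass p μ z v * f (extend z v)
          - μ.real (cylinder v) * f (extend z v)| := Finset.abs_sum_le_sum_abs _ _
    _ ≤ ∑ v : Fin (n + 1) → S, C * |μ.real (cylinder v) - kernelMass p μ z v| :=
      Finset.sum_le_sum fun v _ => by
        rw [← sub_mul, abs_mul, mul_comm, abs_sub_comm]
        exact mul_le_mul_of_nonneg_right (hC _) (abs_nonneg _)
    _ ≤ C * (2 * √(hellingerDefect p μ z n)) := by
      rw [← Finset.mul_sum]
      exact mul_le_mul_of_nonneg_left (sum_abs_sub_le (fun _ => measureReal_nonneg)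
        (kernelMass_nonneg p μ z) (sum_measureReal_cylinder _) (sum_kernelMass hnorm z n)) hC0

/-- Equilibrium states of a normalized potential are fixed by the dual of the transfer operator. -/
lemma IsEquilibriumState.isTransferInvariant {θ L : ℝ} (hθ : θ ∈ Set.Ioo (0 : ℝ) 1)
    (hp : IsLipschitzBound θ p L) (hnorm : IsNormalized p) (hμ : IsEquilibriumState p μ) :
    IsTransferInvariant p μ := by
  obtain ⟨x₀⟩ : Nonempty (ℕ → S) := μ.nonempty_of_neZero
  have : Nonempty S := ⟨x₀ 0⟩
  obtain ⟨ν, hν, hνp⟩ := exists_isTransferInvariant (hp.continuous hθ) hnorm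
  have hνσ := hνp.measurePreserving_shift hnorm
  exact isTransferInvariant_of_free_energy_nonneg hθ hp hnorm hμ.invariant.measurePreserving
    ((hνp.entropy_add_integral_nonneg (hp.continuous hθ) hνσ).trans (hμ.maximal ν ⟨hν, hνσ⟩))

end Equilibrium

end MarkovShift

/-! ### Comparison with the stated constants -/

theorem theorem3 {S : Type*} [Fintype S] [MeasurableSpace S] [DiscreteMeasurableSpace S]
    (θ : ℝ) (hθ : θ ∈ Set.Ioo (0 : ℝ) 1)
    (φp : (ℕ → S) → ℝ) (L : ℝ) (hL : MarkovShift.IsLipschitzBound θ φp L)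
    (hnorm : MarkovShift.IsNormalized φp)
    (μ : MeasureTheory.Measure (ℕ → S)) (hμ : MarkovShift.IsEquilibriumState φp μ)
    (a ε U z₀ : ℝ)
    (ha : a = 1 - Real.exp (-(L * (1 - θ)⁻¹)))
    (hε : ε ∈ Set.Ioo (0 : ℝ) (min (1 - a) (1 - θ)))
    (hU : U = Real.log (1 - ε) / (Real.log (θ * ε * (1 - ε - θ)) - Real.log (2 * L)))
    (hz₀ : z₀ ∈ Set.Ioo (1 : ℝ)
      (min (min (((a + ε / 2) / a) ^ U) ((θ + ε) / θ)) (min ((1 - ε) / θ) (Real.exp 2))))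
    (φ : (ℕ → S) → ℝ) (M : ℝ) (hM : MarkovShift.IsLipschitzBound θ φ M)
    (hmean : ∫ x, φ x ∂μ = 0)
    (u : ℝ) (hu : 0 < u) (n : ℕ) (hn : 1 ≤ n) :
    μ.real {x | u ≤ |(∑ i ∈ Finset.range n, φ (MarkovShift.shift^[i] x)) / (n : ℝ)|}
      ≤ 2 * Real.exp (u * (1 - z₀ ^ (-(1 / 2) : ℝ)) * (1 - a - ε) * Real.log (√z₀)
              / (36 * M * z₀ ^ (1 / 2 : ℝ)))
          * Real.exp (-(u ^ 2 * n * (1 - z₀ ^ (-(1 / 2) : ℝ)) ^ 2 * (1 - a - ε) ^ 2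
              * Real.log (√z₀) ^ 2 / (72 * M ^ 2))) := by
  open MarkovShift in
  let _ : TopologicalSpace S := ⊥
  have _ : DiscreteTopology S := ⟨rfl⟩
  have _ : BorelSpace S := ⟨by
    rw [borel_eq_top_of_discrete]
    exact top_le_iff.1 fun s _ => MeasurableSet.of_discrete⟩
  have hprob := hμ.invariant.isProbabilityMeasure
  have hL1 := hL.one_le
  have hM0 : 0 < M := zero_lt_one.trans_le hM.one_le
  have hinv := hμ.isTransferInvariant hθ hL hnorm
  have h1θ : 0 < 1 - θ := sub_pos.2 hθ.2
  have hK0 : 0 < oscBound θ L M := by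
    unfold oscBound
    positivity
  refine (measureReal_le_abs_average_le (hL.continuous hθ) (hM.continuous hθ) hnorm hinv hmean hK0
    (transferSum_sub_le_oscBound hθ hL hM hnorm) hu hn).trans ?_
  have hz1 := hz₀.1
  have hz2 := (hz₀.2.le.trans (min_le_left _ _)).trans (min_le_left _ _)
  obtain ⟨hD0, hD⟩ := contraction_rate_le_sq hθ hL1 ha hε hU hz1 hz2
  set r := 1 - z₀ ^ (-(1 / 2) : ℝ)
  set l := Real.log (√z₀)
  have hKD : oscBound θ L M * (r * (1 - a - ε) * l) ≤ M :=
    (mul_le_mul_of_nonneg_left hD hK0.le).trans (oscBound_mul_sq_le hθ hL1 hM0.le)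
  -- The first exponential in the claim is at least `1`, so the bound without it suffices.
  have hboundary : 1 ≤ Real.exp (u * r * (1 - a - ε) * l / (36 * M * z₀ ^ (1 / 2 : ℝ))) := by
    refine Real.one_le_exp (div_nonneg ?_ ?_)
    · have := mul_nonneg hu.le hD0
      linarith
    · have := Real.rpow_nonneg (zero_le_one.trans hz1.le) (1 / 2 : ℝ)
      positivity
  have hmain : Real.exp (-(n * u ^ 2 / oscBound θ L M ^ 2))
      ≤ Real.exp (-(u ^ 2 * n * r ^ 2 * (1 - a - ε) ^ 2 * l ^ 2 / (72 * M ^ 2))) := by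
    rw [Real.exp_le_exp, neg_le_neg_iff, div_le_div_iff₀ (by positivity) (by positivity)]
    -- Squaring `K * rate ≤ M` compares the exponents, with the factor `72` to spare.
    have hsq : (oscBound θ L M * (r * (1 - a - ε) * l)) ^ 2 ≤ M ^ 2 :=
      pow_le_pow_left₀ (mul_nonneg hK0.le hD0) hKD 2
    have hnu : 0 ≤ n * u ^ 2 := by positivity
    have hfac : (oscBound θ L M * (r * (1 - a - ε) * l)) ^ 2 ≤ 72 * M ^ 2 := by
      nlinarith [sq_nonneg M]
    calc u ^ 2 * n * r ^ 2 * (1 - a - ε) ^ 2 * l ^ 2 * oscBound θ L M ^ 2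
        = n * u ^ 2 * (oscBound θ L M * (r * (1 - a - ε) * l)) ^ 2 := by ring
      _ ≤ n * u ^ 2 * (72 * M ^ 2) := mul_le_mul_of_nonneg_left hfac hnu
  rw [mul_assoc]
  exact mul_le_mul_of_nonneg_left (hmain.trans
    (le_mul_of_one_le_left (Real.exp_nonneg _) hboundary)) zero_le_two
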